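/- Let $p,K,N\ge 1$ be integers with $K\ge p$ and let $\boldsymbol\Sigma$ be a positive definite Hermitian $p\times p$ matrix. For $m\ge 1$ let $\mathcal W_p^C(m,\boldsymbol\Sigma)$ denote the complex Wishart distribution with $m$ complex degrees of freedom, i.e. the law of $\sum_{k=1}^{m}\boldsymbol X_k\boldsymbol X_k^H$, where $\boldsymbol X_1,\dots,\boldsymbol X_m$ are independent (circularly symmetric) complex Gaussian vectors in $\mathbb C^p$ with mean zero and covariance matrix $E\{\boldsymbol X_k\boldsymbol X_k^H\}=\boldsymbol\Sigma$. For positive definite Hermitian $\boldsymbol P,\boldsymbol S$ put $$\mathrm{Lmap}_{\boldsymbol P}(\boldsymbol S)=\boldsymbol P^{1/2}\log(\boldsymbol P^{-1/2}\boldsymbol S\boldsymbol P^{-1/2})\boldsymbol P^{1/2},$$ where $\log$ is the matrix logarithm of a positive definite Hermitian matrix defined through its spectral decomposition, and for Hermitian $\boldsymbol A$ put $\|\boldsymbol A\|_{\boldsymbol P}=\mathrm{tr}(\boldsymbol P^{-1}\boldsymbol A\boldsymbol P^{-1}\boldsymbol A)^{1/2}$. The intrinsic bias of an estimator $\mathcal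 S$ of $\boldsymbol\Sigma$ is $\mathrm{ibias}(\mathcal S)=\|E\{\mathrm{Lmap}_{\boldsymbol\Sigma}(\mathcal S)\}\|^2_{\boldsymbol\Sigma}$, where the expectation is taken entrywise. Let $\boldsymbol S_1,\dots,\boldsymbol S_N$ be independent and identically distributed random $p\times p$ matrices such that $K\boldsymbol S_n$ has distribution $\mathcal W_p^C(K,\boldsymbol\Sigma)$ for each $n$, and let $\bar{\boldsymbol S}=\frac1N\sum_{n=1}^N\boldsymbol S_n$ be their sample mean. Then $KN\bar{\boldsymbol S}$ has distribution $\mathcal W_p^C(KN,\boldsymbol\Sigma)$, the matrix $\bar{\boldsymbol S}$ is almost surely positive definite, the entries of $\mathrm{Lmap}_{\boldsymbol\Sigma}(\bar{\boldsymbol S})$ are integrable, and $$\mathrm{ibias}(\bar{\boldsymbol S})=\|E\{\mathrm{Lmap}_{\boldsymbol\Sigma}(\bar{\boldsymbol S})\}\|^2_{\boldsymbol\Sigma}=p\,a_0(KN)^2,$$ where, for an integer $m\ge p$, $$a_0(m)=\log\left(\frac1m\Big(\exp\Big\{\sum_{j=1}^p\psi(m-p+j)\Big\}\Big)^{1/p}\right)$$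 and $\psi=\Gamma'/\Gamma$ is the digamma function. -/

import Mathlib

open MeasureTheory ProbabilityTheory
open scoped Matrix ComplexOrder

/-- The product (entrywise Borel) σ-algebra on complex matrices. -/
noncomputable instance matrixMeasurableSpace {m n : Type*} : MeasurableSpace (Matrix m n ℂ) :=
  (inferInstance : MeasurableSpace (m → n → ℂ))

/-- The standard circularly symmetric complex Gaussian law on `ℂ`: the real and imaginary parts are
independent real centred Gaussians of variance `1/2`, so that `E |Z|² = 1`. -/
noncomputable def stdComplexGaussian : Measure ℂ :=
  ((gaussianReal 0 (1 / 2)).prod (gaussianReal 0 (1 / 2))).map Complex.measurableEquivRealProd.symm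

/-- The square root `U diag(√λ₁, …, √λₚ) Uᴴ` of a positive semidefinite Hermitian matrix with
spectral decomposition `U diag(λ₁, …, λₚ) Uᴴ`. -/
noncomputable def matSqrt {p : ℕ} (A : Matrix (Fin p) (Fin p) ℂ) : Matrix (Fin p) (Fin p) ℂ :=
  cfc Real.sqrt A

/-- The logarithm `U diag(log λ₁, …, log λₚ) Uᴴ` of a positive definite Hermitian matrix with
spectral decomposition `U diag(λ₁, …, λₚ) Uᴴ`. -/
noncomputable def matLog {p : ℕ} (A : Matrix (Fin p) (Fin p) ℂ) : Matrix (Fin p) (Fin p) ℂ :=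
  cfc Real.log A

/-- The `p`-dimensional (circularly symmetric) complex Gaussian law with mean zero and covariance
matrix `Sig = E X Xᴴ`: the law of `Sig^{1/2} Z`, where `Z` has independent standard complex
Gaussian coordinates. -/
noncomputable def complexGaussian {p : ℕ} (Sig : Matrix (Fin p) (Fin p) ℂ) :
    Measure (Fin p → ℂ) :=
  (Measure.pi fun _ : Fin p => stdComplexGaussian).map fun z => matSqrt Sig *ᵥ z

/-- The complex Wishart law `W_p^C(K, Sig)` with `K` complex degrees of freedom: the law of
`∑ₖ Xₖ Xₖᴴ` for `K` independent complex Gaussian vectors with mean zero and covariance `Sig`. -/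
noncomputable def complexWishart {p : ℕ} (K : ℕ) (Sig : Matrix (Fin p) (Fin p) ℂ) :
    Measure (Matrix (Fin p) (Fin p) ℂ) :=
  (Measure.pi fun _ : Fin K => complexGaussian Sig).map
    fun X => ∑ k, Matrix.vecMulVec (X k) (star (X k))

/-- The scaled Frobenius inner product `tr(P⁻¹ A P⁻¹ B)` on the tangent space (the Hermitian
matrices) at the positive definite matrix `P`; the trace is real there. -/
noncomputable def scaledInner {p : ℕ} (P A B : Matrix (Fin p) (Fin p) ℂ) : ℝ :=
  (P⁻¹ * A * P⁻¹ * B).trace.re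

/-- The norm of the tangent vector `A` at `P`. -/
noncomputable def scaledNorm {p : ℕ} (P A : Matrix (Fin p) (Fin p) ℂ) : ℝ :=
  Real.sqrt (scaledInner P A A)

/-- The Riemannian logarithmic map
`Lmap_P(S) = P^{1/2} log(P^{-1/2} S P^{-1/2}) P^{1/2}`. -/
noncomputable def Lmap {p : ℕ} (P S : Matrix (Fin p) (Fin p) ℂ) : Matrix (Fin p) (Fin p) ℂ :=
  matSqrt P * matLog ((matSqrt P)⁻¹ * S * (matSqrt P)⁻¹) * matSqrt P

/-- The (entrywise) expectation of a random matrix. -/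
noncomputable def matExpect {Ω : Type*} [MeasurableSpace Ω] {p : ℕ} (μ : Measure Ω)
    (X : Ω → Matrix (Fin p) (Fin p) ℂ) : Matrix (Fin p) (Fin p) ℂ :=
  Matrix.of fun i j => ∫ ω, X ω i j ∂μ

/-- The intrinsic bias `‖E{Lmap_Sig(T)}‖²_Sig` of an estimator `T` of `Sig`. -/
noncomputable def ibias {Ω : Type*} [MeasurableSpace Ω] {p : ℕ} (μ : Measure Ω)
    (Sig : Matrix (Fin p) (Fin p) ℂ) (T : Ω → Matrix (Fin p) (Fin p) ℂ) : ℝ :=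
  scaledNorm Sig (matExpect μ fun ω => Lmap Sig (T ω)) ^ 2

/-- The ordinary sample mean of `N` random matrices. -/
noncomputable def sampleMean {Ω : Type*} {p N : ℕ} (S : Fin N → Ω → Matrix (Fin p) (Fin p) ℂ)
    (ω : Ω) : Matrix (Fin p) (Fin p) ℂ :=
  (1 / (N : ℝ)) • ∑ n, S n ω

/-- The constant `a = K⁻¹ (exp (∑_{j=1}^p ψ(K - p + j)))^{1/p}`, where `ψ` is the digamma
function (which is real at positive real arguments). -/
noncomputable def aConst (p K : ℕ) : ℝ :=
  (1 / (K : ℝ)) *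
    (Real.exp (∑ j ∈ Finset.Icc 1 p, (Complex.digamma ((K : ℂ) - p + j)).re)) ^ (1 / (p : ℝ))

/-- `a₀(K) = log a`. -/
noncomputable def aZero (p K : ℕ) : ℝ := Real.log (aConst p K)

/-! Put m = KN and R = Sig^{1/2}. Regrouping N blocks of K Gaussian vectors into one family of m
shows that m times the sample mean T is Wishart, so the whitened matrix R⁻¹ T R⁻¹ has the law of
W/m, with W Wishart of identity scale. As `Lmap Sig T` is R log(R⁻¹ T R⁻¹) R, everything reduces to
E log(W/m).

The Gaussian law is unitarily invariant, hence so is the law of W/m under conjugation; the logarithm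
commutes with conjugation, so E log(W/m) commutes with every unitary and is a scalar matrix c • 1.
Taking traces, pc = E log det(W/m). Then E `Lmap` = c • Sig, whose squared norm is pc².

To compute E log det W, write det W as the Gram determinant of a p × m Gaussian matrix. A unitary
rotating the first row onto the first axis splits off its squared norm and leaves an independent
(p-1) × (m-1) Gaussian Gram determinant (`stdGaussianMat_map_gramDet`). So det W is distributed as a
product of independent Gamma variables of shapes m, m-1, ..., m-p+1, and E log of a Gamma(s)
variable is ψ(s), the logarithmic derivative of the Gamma integral. This gives c = a₀(m).
Integrability follows from the bound 2 tr A - log det A on the entries of log A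
(`norm_matLog_apply_le`). -/

open scoped ENNReal NNReal

/-! ### Densities under finite products and measurable equivalences -/

section Density

theorem lintegral_pi_fin_prod_eq_prod {n : ℕ} {α : Type*} [MeasurableSpace α]
    {ν : Fin n → Measure α} [∀ i, SigmaFinite (ν i)] (f : Fin n → α → ℝ≥0∞) (hf : ∀ i, Measurable (f i)) :
    ∫⁻ x, ∏ i, f i (x i) ∂(Measure.pi ν) = ∏ i, ∫⁻ x, f i x ∂(ν i) := by
  induction n with
  | zero => simp
  | succ n ih =>
    rw [← ((measurePreserving_piFinSuccAbove ν 0).symm).lintegral_comp_emb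
      (MeasurableEquiv.measurableEmbedding _), Fin.prod_univ_succ,
      ← ih _ fun i => hf i.succ, ← lintegral_prod_mul (hf 0).aemeasurable]
    · refine lintegral_congr fun x => ?_
      rw [Fin.prod_univ_succ]
      simp [MeasurableEquiv.piFinSuccAbove_symm_apply, Fin.insertNthEquiv]
    · exact (Finset.measurable_prod _ fun i _ =>
        (hf i.succ).comp (measurable_pi_apply i)).aemeasurable

theorem pi_fin_withDensity {n : ℕ} {α : Type*} [MeasurableSpace α]
    {ν : Fin n → Measure α} [∀ i, SigmaFinite (ν i)] (f : Fin n → α → ℝ≥0∞) (hf : ∀ i, Measurable (f i))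
    [∀ i, SigmaFinite ((ν i).withDensity (f i))] :
    Measure.pi (fun i => (ν i).withDensity (f i)) =
      (Measure.pi ν).withDensity fun x => ∏ i, f i (x i) := by
  refine Measure.pi_eq fun s hs => ?_
  rw [withDensity_apply _ (MeasurableSet.univ_pi hs),
    ← lintegral_indicator (MeasurableSet.univ_pi hs)]
  have key : (Set.univ.pi s).indicator (fun x => ∏ i, f i (x i)) =
      fun x : Fin n → α => ∏ i, (s i).indicator (f i) (x i) := by
    classical
    ext x
    by_cases hx : x ∈ Set.univ.pi s
    · rw [Set.indicator_of_mem hx]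
      exact Finset.prod_congr rfl fun i _ => (Set.indicator_of_mem (hx i trivial) _).symm
    · rw [Set.indicator_of_notMem hx]
      simp only [Set.mem_pi, Set.mem_univ, true_imp_iff, not_forall] at hx
      obtain ⟨i, hi⟩ := hx
      exact (Finset.prod_eq_zero (Finset.mem_univ i) (Set.indicator_of_notMem hi _)).symm
  rw [key, lintegral_pi_fin_prod_eq_prod _ fun i => (hf i).indicator (hs i)]
  refine Finset.prod_congr rfl fun i _ => ?_
  rw [lintegral_indicator (hs i), withDensity_apply _ (hs i)]

theorem map_withDensity_measurableEquiv {α β : Type*} [MeasurableSpace α] [MeasurableSpace β]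
    (e : α ≃ᵐ β) (ν : Measure α) (f : α → ℝ≥0∞) :
    (ν.withDensity f).map e = (ν.map e).withDensity (f ∘ e.symm) := by
  ext s hs
  rw [e.map_apply, withDensity_apply _ (e.measurable hs), withDensity_apply _ hs,
    e.restrict_map, lintegral_map_equiv]
  simp

end Density

/-! ### Gaussian vectors: density and unitary invariance -/

section StdGaussian

/-- The density of the standard complex Gaussian law. -/
noncomputable def stdComplexGaussianPDF (z : ℂ) : ℝ≥0∞ :=
  ENNReal.ofReal (Real.pi⁻¹ * Real.exp (-‖z‖ ^ 2))

theorem measurable_stdComplexGaussianPDF : Measurable stdComplexGaussianPDF := by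
  unfold stdComplexGaussianPDF
  fun_prop

theorem gaussianPDF_half_mul (x y : ℝ) :
    gaussianPDF 0 (1 / 2) x * gaussianPDF 0 (1 / 2) y =
      ENNReal.ofReal (Real.pi⁻¹ * Real.exp (-(x ^ 2 + y ^ 2))) := by
  rw [gaussianPDF, gaussianPDF, ← ENNReal.ofReal_mul (gaussianPDFReal_nonneg _ _ _)]
  congr 1
  simp only [gaussianPDFReal, sub_zero]
  have h1 : (2 * Real.pi * ((1 / 2 : ℝ≥0) : ℝ)) = Real.pi := by push_cast; ring
  have h2 : (2 * ((1 / 2 : ℝ≥0) : ℝ)) = 1 := by push_cast; ring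
  rw [h1, h2, mul_mul_mul_comm, ← mul_inv, Real.mul_self_sqrt Real.pi_pos.le, ← Real.exp_add]
  congr 2
  ring

instance : IsProbabilityMeasure stdComplexGaussian :=
  Measure.isProbabilityMeasure_map (MeasurableEquiv.measurable _).aemeasurable

theorem stdComplexGaussian_eq_withDensity :
    stdComplexGaussian = (volume : Measure ℂ).withDensity stdComplexGaussianPDF := by
  unfold stdComplexGaussian
  rw [gaussianReal_of_var_ne_zero _ (by norm_num),
    prod_withDensity (measurable_gaussianPDF _ _) (measurable_gaussianPDF _ _),
    map_withDensity_measurableEquiv, ← Measure.volume_eq_prod,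
    (Complex.volume_preserving_equiv_real_prod.symm).map_eq]
  congr 1
  ext z
  simp only [Function.comp_apply, MeasurableEquiv.symm_symm,
    Complex.measurableEquivRealProd_apply, gaussianPDF_half_mul, stdComplexGaussianPDF]
  rw [← Complex.normSq_eq_norm_sq, Complex.normSq_apply]
  ring_nf

/-- The law of a vector of `n` independent standard complex Gaussian variables. -/
noncomputable abbrev stdGaussianVec (n : ℕ) : Measure (Fin n → ℂ) :=
  Measure.pi fun _ => stdComplexGaussian

/-- The law of an `n × k` matrix of independent standard complex Gaussian variables. -/
noncomputable abbrev stdGaussianMat (n k : ℕ) : Measure (Fin n → Fin k → ℂ) :=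
  Measure.pi fun _ => stdGaussianVec k

theorem stdGaussianVec_eq_withDensity (n : ℕ) :
    stdGaussianVec n = (volume : Measure (Fin n → ℂ)).withDensity
      fun z => ENNReal.ofReal ((Real.pi⁻¹) ^ n * Real.exp (-∑ i, ‖z i‖ ^ 2)) := by
  have : SigmaFinite ((volume : Measure ℂ).withDensity stdComplexGaussianPDF) := by
    rw [← stdComplexGaussian_eq_withDensity]; infer_instance
  rw [stdGaussianVec]
  simp_rw [stdComplexGaussian_eq_withDensity]
  rw [pi_fin_withDensity _ fun _ => measurable_stdComplexGaussianPDF, volume_pi]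
  congr 1
  ext z
  unfold stdComplexGaussianPDF
  rw [← ENNReal.ofReal_prod_of_nonneg fun i _ => by positivity, Finset.prod_mul_distrib,
    ← Real.exp_sum]
  simp

/-- Sum of squared absolute values of the coordinates. -/
noncomputable def vecNormSq {n : ℕ} (z : Fin n → ℂ) : ℝ := ∑ i, ‖z i‖ ^ 2

theorem ofReal_vecNormSq {n : ℕ} (z : Fin n → ℂ) : (vecNormSq z : ℂ) = z ⬝ᵥ star z := by
  simp [vecNormSq, dotProduct, Complex.mul_conj, Complex.normSq_eq_norm_sq]

theorem vecNormSq_nonneg {n : ℕ} (z : Fin n → ℂ) : 0 ≤ vecNormSq z :=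
  Finset.sum_nonneg fun _ _ => by positivity

theorem measurable_vecNormSq {n : ℕ} : Measurable (vecNormSq (n := n)) := by
  unfold vecNormSq
  fun_prop

theorem vecNormSq_unitary_mulVec {n : ℕ} (U : Matrix (Fin n) (Fin n) ℂ)
    (hU : U ∈ Matrix.unitaryGroup (Fin n) ℂ) (z : Fin n → ℂ) :
    vecNormSq (U *ᵥ z) = vecNormSq z := by
  have h := Matrix.mem_unitaryGroup_iff'.1 hU
  rw [← Complex.ofReal_inj, ofReal_vecNormSq, ofReal_vecNormSq, Matrix.star_mulVec,
    dotProduct_comm, Matrix.dotProduct_mulVec, Matrix.vecMul_vecMul, ← Matrix.star_eq_conjTranspose,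
    h, Matrix.vecMul_one, dotProduct_comm]

/-- The density depends only on the norm, so a linear isometry can change the law only by its
constant Jacobian factor. Total mass one forces that factor to be 1, with no determinant computed.
-/
theorem stdGaussianVec_map_unitary {n : ℕ} (U : Matrix (Fin n) (Fin n) ℂ)
    (hU : U ∈ Matrix.unitaryGroup (Fin n) ℂ) :
    (stdGaussianVec n).map (fun z => U *ᵥ z) = stdGaussianVec n := by
  have h1 := Matrix.mem_unitaryGroup_iff.1 hU
  have h2 := Matrix.mem_unitaryGroup_iff'.1 hU
  let e : (Fin n → ℂ) ≃ₗ[ℝ] (Fin n → ℂ) :=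
    { toFun := fun z => U *ᵥ z
      map_add' := fun x y => Matrix.mulVec_add _ _ _
      map_smul' := fun c x => Matrix.mulVec_smul _ _ _
      invFun := fun z => star U *ᵥ z
      left_inv := fun z => by simp [h2]
      right_inv := fun z => by simp [h1] }
  let e' : (Fin n → ℂ) ≃ᵐ (Fin n → ℂ) := e.toContinuousLinearEquiv.toHomeomorph.toMeasurableEquiv
  have hvol : (volume : Measure (Fin n → ℂ)).map e' =
      ENNReal.ofReal |(LinearMap.det (e : (Fin n → ℂ) →ₗ[ℝ] (Fin n → ℂ)))⁻¹| • volume :=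
    Measure.map_linearMap_addHaar_eq_smul_addHaar volume (LinearEquiv.isUnit_det' e).ne_zero
  have hmap : (stdGaussianVec n).map e' =
      ENNReal.ofReal |(LinearMap.det (e : (Fin n → ℂ) →ₗ[ℝ] (Fin n → ℂ)))⁻¹| •
        stdGaussianVec n := by
    rw [stdGaussianVec_eq_withDensity, map_withDensity_measurableEquiv, hvol,
      withDensity_smul_measure]
    congr 2
    ext z
    have : vecNormSq (e'.symm z) = vecNormSq z :=
      vecNormSq_unitary_mulVec (star U) (Unitary.star_mem hU) z
    simp only [vecNormSq] at this
    simp [this]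
  have hone := congrArg (fun ν => ν Set.univ) hmap
  simp only [Measure.smul_apply, smul_eq_mul, measure_univ, mul_one] at hone
  rw [Measure.map_apply e'.measurable MeasurableSet.univ, Set.preimage_univ, measure_univ] at hone
  rw [← hone, one_smul] at hmap
  exact hmap

end StdGaussian

/-! ### Logarithmic moments of the Gamma density -/

section GammaLog

theorem integrableOn_log_mul_rpow_mul_exp_neg {s : ℂ} (hs : 0 < s.re) :
    IntegrableOn (fun t : ℝ => (t : ℂ) ^ (s - 1) * (Real.log t * Real.exp (-t))) (Set.Ioi 0) ∧
      HasDerivAt Complex.GammaIntegral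
        (∫ t : ℝ in Set.Ioi 0, (t : ℂ) ^ (s - 1) * (Real.log t * Real.exp (-t))) s := by
  refine ⟨?_, Complex.hasDerivAt_GammaIntegral hs⟩
  -- The Mellin transform of exp(-t) may be differentiated under the integral for 0 < re s: exp(-t)
  -- is O(t^(-a)) at infinity for any a, here re s + 1, and bounded near 0, whence b = 0.
  have key := (mellin_hasDerivAt_of_isBigO_rpow (E := ℂ) (s := s) (a := s.re + 1) (b := 0)
    (f := fun t : ℝ => ((Real.exp (-t) : ℝ) : ℂ)) ?_ ?_ (lt_add_one _) ?_ hs).1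
  · refine key.congr_fun (fun t _ => ?_) measurableSet_Ioi
    simp [smul_eq_mul]
  · refine (Continuous.continuousOn ?_).locallyIntegrableOn measurableSet_Ioi
    exact Complex.continuous_ofReal.comp (Real.continuous_exp.comp continuous_neg)
  · rw [← Asymptotics.isBigO_norm_left]
    simp_rw [Complex.norm_real, Asymptotics.isBigO_norm_left]
    simpa only [neg_one_mul] using (isLittleO_exp_neg_mul_rpow_atTop zero_lt_one _).isBigO
  · simp_rw [neg_zero, Real.rpow_zero]
    refine Asymptotics.isBigO_const_of_tendsto (?_ : Filter.Tendsto _ _ (nhds (1 : ℂ))) one_ne_zero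
    rw [(by simp : (1 : ℂ) = Real.exp (-0))]
    exact (Complex.continuous_ofReal.comp
      (Real.continuous_exp.comp continuous_neg)).continuousWithinAt

theorem integrableOn_pow_mul_exp_neg_mul_log (n : ℕ) :
    IntegrableOn (fun t : ℝ => t ^ n * Real.exp (-t) * Real.log t) (Set.Ioi 0) := by
  have h := (integrableOn_log_mul_rpow_mul_exp_neg (s := (n : ℂ) + 1)
    (by simp; positivity)).1.re
  refine h.congr (Filter.Eventually.of_forall fun t => ?_)
  beta_reduce
  rw [add_sub_cancel_right, Complex.cpow_natCast]
  norm_cast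
  simp only [RCLike.re_to_complex, Complex.ofReal_re]
  ring

theorem integral_pow_mul_exp_neg (n : ℕ) :
    ∫ t in Set.Ioi (0 : ℝ), t ^ n * Real.exp (-t) = Real.Gamma (n + 1) := by
  rw [Real.Gamma_eq_integral (by positivity)]
  refine setIntegral_congr_fun measurableSet_Ioi fun t _ => ?_
  simp only [add_sub_cancel_right, Real.rpow_natCast]
  ring

theorem integrableOn_pow_mul_exp_neg (n : ℕ) :
    IntegrableOn (fun t : ℝ => t ^ n * Real.exp (-t)) (Set.Ioi 0) := by
  refine (Real.GammaIntegral_convergent (s := n + 1) (by positivity)).congr_fun (fun t _ => ?_)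
    measurableSet_Ioi
  simp only [add_sub_cancel_right, Real.rpow_natCast]
  ring

/-- The left side is Γ'(n+1), by differentiating the Gamma integral, and Γ' = ψ Γ. -/
theorem integral_pow_mul_exp_neg_mul_log (n : ℕ) :
    ∫ t in Set.Ioi (0 : ℝ), t ^ n * Real.exp (-t) * Real.log t =
      (Complex.digamma ((n : ℂ) + 1)).re * Real.Gamma (n + 1) := by
  have hs : 0 < ((n : ℂ) + 1).re := by simp; positivity
  have h := Complex.hasDerivAt_GammaIntegral hs
  have hev : Complex.Gamma =ᶠ[nhds ((n : ℂ) + 1)] Complex.GammaIntegral := by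
    have : IsOpen {s : ℂ | 0 < s.re} := Complex.continuous_re.isOpen_preimage _ isOpen_Ioi
    filter_upwards [this.mem_nhds hs] with a ha using Complex.Gamma_eq_integral ha
  have hd := (h.congr_of_eventuallyEq hev).deriv
  have hI : ∫ t : ℝ in Set.Ioi 0, (t : ℂ) ^ ((n : ℂ) + 1 - 1) * (Real.log t * Real.exp (-t)) =
      ((∫ t in Set.Ioi (0 : ℝ), t ^ n * Real.exp (-t) * Real.log t : ℝ) : ℂ) := by
    rw [← integral_complex_ofReal]
    refine setIntegral_congr_fun measurableSet_Ioi fun t _ => ?_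
    simp only [add_sub_cancel_right, Complex.cpow_natCast]
    push_cast
    ring
  rw [hI] at hd
  have hG : Complex.Gamma ((n : ℂ) + 1) = (Real.Gamma (n + 1) : ℝ) := by
    rw [← Complex.Gamma_ofReal]; push_cast; rfl
  have hpos : Real.Gamma (n + 1) ≠ 0 := (Real.Gamma_pos_of_pos (by positivity)).ne'
  rw [Complex.digamma_def, logDeriv_apply, hd, hG, ← Complex.ofReal_div, Complex.ofReal_re,
    div_mul_cancel₀ _ hpos]

end GammaLog

/-! ### The squared norm of a Gaussian vector -/

section Radial

/-- Under the law of `n + 1` independent standard complex Gaussian variables, `‖z‖²` has the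
Gamma distribution with shape `n + 1`, up to a normalising constant. -/
theorem exists_radial_stdGaussianVec (n : ℕ) : ∃ c : ℝ, ∀ f : ℝ → ℝ,
    (IntegrableOn (fun t => t ^ n * Real.exp (-t) * f t) (Set.Ioi 0) →
      Integrable (fun z => f (vecNormSq z)) (stdGaussianVec (n + 1))) ∧
    ∫ z, f (vecNormSq z) ∂stdGaussianVec (n + 1) =
      c * ∫ t in Set.Ioi (0 : ℝ), t ^ n * Real.exp (-t) * f t := by
  -- Polar coordinates need the Euclidean norm, whereas the function space carries the sup norm; the
  -- volume is therefore transported to a real Euclidean space of dimension 2(n+1).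
  let E := EuclideanSpace ℂ (Fin (n + 1))
  let _ : InnerProductSpace ℝ E := InnerProductSpace.rclikeToReal ℂ E
  let e : (Fin (n + 1) → ℂ) ≃L[ℝ] E :=
    (PiLp.continuousLinearEquiv 2 ℝ fun _ : Fin (n + 1) => ℂ).symm
  let e' : (Fin (n + 1) → ℂ) ≃ᵐ E := e.toHomeomorph.toMeasurableEquiv
  let ν : Measure E := (volume : Measure (Fin (n + 1) → ℂ)).map e'
  have : ν.IsAddHaarMeasure := e.isAddHaarMeasure_map volume
  have hnorm : ∀ z, ‖e' z‖ ^ 2 = vecNormSq z := fun z => by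
    rw [EuclideanSpace.norm_sq_eq]; rfl
  have hdim : Module.finrank ℝ E = 2 * (n + 1) := by
    rw [← e.toLinearEquiv.finrank_eq, Module.finrank_pi_fintype]
    simp [Complex.finrank_real_complex, mul_comm]
  have hdim' : Module.finrank ℝ E - 1 = 2 * n + 1 := by rw [hdim]; omega
  let F : (ℝ → ℝ) → ℝ → ℝ := fun f r =>
    (Real.pi⁻¹ ^ (n + 1) * Real.exp (-r ^ 2)) * f (r ^ 2)
  have hdens : Measurable fun z : Fin (n + 1) → ℂ =>
      ENNReal.ofReal ((Real.pi⁻¹) ^ (n + 1) * Real.exp (-∑ i, ‖z i‖ ^ 2)) := by fun_prop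
  have hFz : ∀ f z, F f ‖e' z‖ = (ENNReal.ofReal ((Real.pi⁻¹) ^ (n + 1) *
      Real.exp (-∑ i, ‖z i‖ ^ 2))).toReal • f (vecNormSq z) := fun f z => by
    rw [ENNReal.toReal_ofReal (by positivity), smul_eq_mul]
    simp only [F]
    rw [hnorm]
    rfl
  let g : (ℝ → ℝ) → ℝ → ℝ := fun f t => t ^ n * Real.exp (-t) * f t
  have hFg : ∀ f, Set.EqOn (fun y : ℝ => y ^ (2 * n + 1) • F f y)
      (fun y => (Real.pi⁻¹ ^ (n + 1) / 2) * ((2 * y ^ ((2 : ℝ) - 1)) • g f (y ^ (2 : ℝ))))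
      (Set.Ioi 0) := fun f y _ => by
    have h1 : y ^ ((2 : ℝ) - 1) = y := by norm_num
    simp only [F, g, smul_eq_mul, Real.rpow_two, h1]
    ring
  -- Dimension times unit ball volume comes from polar coordinates, the power of π from the density,
  -- and the factor 1/2 from substituting t = r².
  refine ⟨(2 * (n + 1)) * ν.real (Metric.ball 0 1) * (Real.pi⁻¹ ^ (n + 1) / 2),
    fun f => ⟨fun hf => ?_, ?_⟩⟩
  · rw [stdGaussianVec_eq_withDensity, integrable_withDensity_iff_integrable_smul' hdens (by simp)]
    have h1 : Integrable (fun x => F f ‖x‖) ν := by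
      rw [integrable_fun_norm_addHaar, hdim']
      refine IntegrableOn.congr_fun ?_ (hFg f).symm measurableSet_Ioi
      refine Integrable.const_mul ?_ _
      have := (integrableOn_Ioi_comp_rpow_iff (g f) (two_ne_zero (α := ℝ))).2 hf
      simpa only [abs_two] using! this
    refine ((e'.measurableEmbedding.integrable_map_iff).1 h1).congr
      (Filter.Eventually.of_forall fun z => ?_)
    exact hFz f z
  · rw [stdGaussianVec_eq_withDensity, integral_withDensity_eq_integral_toReal_smul hdens (by simp)]
    simp_rw [← hFz f]
    rw [← integral_map_equiv e' (fun x => F f ‖x‖), integral_fun_norm_addHaar, hdim', hdim,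
      setIntegral_congr_fun measurableSet_Ioi (hFg f), integral_const_mul,
      integral_comp_rpow_Ioi_of_pos two_pos]
    simp only [nsmul_eq_mul, smul_eq_mul, g, ν]
    push_cast
    ring

theorem integrable_comp_vecNormSq (n : ℕ) (f : ℝ → ℝ)
    (hf : IntegrableOn (fun t => t ^ n * Real.exp (-t) * f t) (Set.Ioi 0)) :
    Integrable (fun z => f (vecNormSq z)) (stdGaussianVec (n + 1)) := by
  obtain ⟨c, hc⟩ := exists_radial_stdGaussianVec n
  exact (hc f).1 hf

/-- The case f = 1 identifies the unknown radial constant as 1/Γ(n+1). -/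
theorem integral_comp_vecNormSq (n : ℕ) (f : ℝ → ℝ) :
    ∫ z, f (vecNormSq z) ∂stdGaussianVec (n + 1) =
      (∫ t in Set.Ioi (0 : ℝ), t ^ n * Real.exp (-t) * f t) / Real.Gamma (n + 1) := by
  obtain ⟨c, hc⟩ := exists_radial_stdGaussianVec n
  have h1 := (hc fun _ => 1).2
  simp only [mul_one, integral_pow_mul_exp_neg, integral_const, probReal_univ, smul_eq_mul] at h1
  have hpos : Real.Gamma (n + 1) ≠ 0 := (Real.Gamma_pos_of_pos (by positivity)).ne'
  rw [(hc f).2, eq_div_iff hpos, mul_right_comm, ← h1, one_mul]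

theorem integrable_log_vecNormSq (n : ℕ) :
    Integrable (fun z => Real.log (vecNormSq z)) (stdGaussianVec (n + 1)) :=
  integrable_comp_vecNormSq n Real.log (integrableOn_pow_mul_exp_neg_mul_log n)

theorem integral_log_vecNormSq (n : ℕ) :
    ∫ z, Real.log (vecNormSq z) ∂stdGaussianVec (n + 1) = (Complex.digamma ((n : ℂ) + 1)).re := by
  rw [integral_comp_vecNormSq, integral_pow_mul_exp_neg_mul_log,
    mul_div_cancel_right₀ _ (Real.Gamma_pos_of_pos (by positivity)).ne']

theorem integrable_vecNormSq (n : ℕ) : Integrable vecNormSq (stdGaussianVec n) := by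
  cases n with
  | zero =>
    have : (vecNormSq : (Fin 0 → ℂ) → ℝ) = fun _ => 0 := by ext z; simp [vecNormSq]
    rw [this]; exact integrable_zero _ _ _
  | succ n =>
    refine integrable_comp_vecNormSq n id ?_
    refine (integrableOn_pow_mul_exp_neg (n + 1)).congr_fun (fun t _ => ?_) measurableSet_Ioi
    simp only [id]
    ring

theorem ae_vecNormSq_pos (n : ℕ) : ∀ᵐ z ∂stdGaussianVec (n + 1), 0 < vecNormSq z := by
  have hac : stdGaussianVec (n + 1) ≪ volume := by
    rw [stdGaussianVec_eq_withDensity]; exact withDensity_absolutelyContinuous _ _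
  have h0 : ∀ᵐ z ∂(volume : Measure (Fin (n + 1) → ℂ)), z ≠ 0 := by
    rw [ae_iff]; simp
  filter_upwards [hac.ae_le h0] with z hz
  refine (vecNormSq_nonneg z).lt_of_ne fun h => hz ?_
  funext i
  have := (Finset.sum_eq_zero_iff_of_nonneg fun i _ => by positivity).1 h.symm i
    (Finset.mem_univ i)
  simpa using this

end Radial

/-! ### Gram determinants of Gaussian matrices -/

section GramDet

theorem det_of_row_zero {R : Type*} [CommRing R] {n : ℕ} (A : Matrix (Fin (n + 1)) (Fin (n + 1)) R)
    (h : ∀ j : Fin n, A 0 j.succ = 0) :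
    A.det = A 0 0 * (A.submatrix Fin.succ Fin.succ).det := by
  rw [Matrix.det_succ_row_zero, Fin.sum_univ_succ, Finset.sum_eq_zero fun j _ => by simp [h j]]
  simp

/-- The determinant of the Gram matrix `Z Zᴴ` of the rows of `Z`. -/
noncomputable def gramDet {n k : ℕ} (Z : Fin n → Fin k → ℂ) : ℝ :=
  ((Matrix.of Z * (Matrix.of Z)ᴴ).det).re

theorem ofReal_gramDet {n k : ℕ} (Z : Fin n → Fin k → ℂ) :
    (gramDet Z : ℂ) = (Matrix.of Z * (Matrix.of Z)ᴴ).det :=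
  (Complex.eq_re_of_ofReal_le (r := 0) (by
    simpa using (Matrix.posSemidef_self_mul_conjTranspose (Matrix.of Z)).det_nonneg)).symm

theorem measurable_gramDet {n k : ℕ} : Measurable (gramDet (n := n) (k := k)) := by
  refine Continuous.measurable ?_
  unfold gramDet
  refine Complex.continuous_re.comp (Continuous.matrix_det ?_)
  exact (continuous_id (X := Matrix (Fin n) (Fin k) ℂ)).matrix_mul
    (continuous_id (X := Matrix (Fin n) (Fin k) ℂ)).matrix_conjTranspose

/-- A = L B, where B is block diagonal with blocks 1 and the lower right part of A, and L is the
identity with its first column replaced by that of A. Hence det(A Aᴴ) = |det L|² det(B Bᴴ), and det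
L = A 0 0. -/
theorem gramDet_eq_of_row_zero {n k : ℕ} (A : Fin (n + 1) → Fin (k + 1) → ℂ)
    (h : ∀ j : Fin k, A 0 j.succ = 0) :
    gramDet A = ‖A 0 0‖ ^ 2 * gramDet fun i j => A i.succ j.succ := by
  let L : Matrix (Fin (n + 1)) (Fin (n + 1)) ℂ :=
    Matrix.of fun i => Fin.cons (A i 0) fun j => if i = j.succ then 1 else 0
  let B : Matrix (Fin (n + 1)) (Fin (k + 1)) ℂ :=
    Matrix.of (Fin.cons (Fin.cons 1 0) fun i => Fin.cons 0 fun j => A i.succ j.succ)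
  have hLB : Matrix.of A = L * B := by
    ext i j
    rw [Matrix.mul_apply, Fin.sum_univ_succ]
    refine Fin.cases ?_ (fun i => ?_) i <;> refine Fin.cases ?_ (fun j => ?_) j <;>
      simp [L, B, h, (Fin.succ_ne_zero _).symm]
  have hL : L.det = A 0 0 := by
    rw [det_of_row_zero L fun j => by simp [L, (Fin.succ_ne_zero _).symm]]
    have : L.submatrix Fin.succ Fin.succ = 1 := by
      ext i j; simp [L, Matrix.one_apply]
    rw [this]; simp [L]
  have hB : (B * Bᴴ).det = (gramDet fun i j => A i.succ j.succ : ℝ) := by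
    rw [ofReal_gramDet, det_of_row_zero]
    · have : (B * Bᴴ).submatrix Fin.succ Fin.succ =
          (Matrix.of fun i (j : Fin k) => A i.succ j.succ) *
            (Matrix.of fun i (j : Fin k) => A i.succ j.succ)ᴴ := by
        ext i j
        simp [Matrix.mul_apply, Fin.sum_univ_succ, B]
      rw [this]
      simp [Matrix.mul_apply, Fin.sum_univ_succ, B]
    · intro j
      simp [Matrix.mul_apply, Fin.sum_univ_succ, B]
  rw [← Complex.ofReal_inj, ofReal_gramDet, hLB, Matrix.conjTranspose_mul,
    show L * B * (Bᴴ * Lᴴ) = L * (B * Bᴴ) * Lᴴ by simp only [Matrix.mul_assoc], Matrix.det_mul,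
    Matrix.det_mul, Matrix.det_conjTranspose, hL, hB]
  push_cast
  rw [mul_right_comm]
  congr 1
  simpa using! Complex.mul_conj' (A 0 0)

theorem gramDet_mul_unitary {n k : ℕ} (Z : Fin n → Fin k → ℂ) (U : Matrix (Fin k) (Fin k) ℂ)
    (hU : U ∈ Matrix.unitaryGroup (Fin k) ℂ) : gramDet (fun i => Z i ᵥ* U) = gramDet Z := by
  have h : Matrix.of (fun i => Z i ᵥ* U) = Matrix.of Z * U := by
    ext i j; rfl
  unfold gramDet
  rw [h, Matrix.conjTranspose_mul, Matrix.mul_assoc, ← Matrix.mul_assoc U,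
    ← Matrix.star_eq_conjTranspose U, Matrix.mem_unitaryGroup_iff.1 hU, Matrix.one_mul]

theorem exists_unitary_vecMul_eq {k : ℕ} (r : Fin (k + 1) → ℂ) :
    ∃ U ∈ Matrix.unitaryGroup (Fin (k + 1)) ℂ,
      ‖(r ᵥ* U) 0‖ ^ 2 = vecNormSq r ∧ ∀ j : Fin k, (r ᵥ* U) j.succ = 0 := by
  rcases eq_or_ne r 0 with rfl | hr
  · exact ⟨1, one_mem _, by simp [vecNormSq], by simp⟩
  -- The inner product is conjugate linear on the left, so the entries of r ᵥ* U are the inner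
  -- products of star r with the columns of U. The columns form an orthonormal basis starting with
  -- star r normalised.
  let x : EuclideanSpace ℂ (Fin (k + 1)) := WithLp.toLp 2 (star r)
  have hx : x ≠ 0 := fun h => hr (by
    have := congrArg (fun y : EuclideanSpace ℂ (Fin (k + 1)) => star (WithLp.ofLp y)) h
    simpa [x] using this)
  have hxn : (‖x‖ : ℂ) ≠ 0 := by simpa using hx
  let v : Fin (k + 1) → EuclideanSpace ℂ (Fin (k + 1)) := fun _ => (‖x‖ : ℂ)⁻¹ • x
  have hv : Orthonormal ℂ (({0} : Set (Fin (k + 1))).domRestrict v) := by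
    refine ⟨fun i => ?_, fun i j hij => (hij (Subsingleton.elim i j)).elim⟩
    simp [v, norm_smul, hx]
  obtain ⟨b, hb⟩ := hv.exists_orthonormalBasis_extension_of_card_eq (by simp)
  have hb0 : x = (‖x‖ : ℂ) • b 0 := by
    rw [hb 0 rfl, smul_inv_smul₀ hxn]
  let U : Matrix (Fin (k + 1)) (Fin (k + 1)) ℂ := Matrix.of fun i j => b j i
  have hrU : ∀ j, (r ᵥ* U) j = inner ℂ x (b j) := fun j => by
    simp [Matrix.vecMul, dotProduct, U, x, PiLp.inner_apply, mul_comm]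
  refine ⟨U, ?_, ?_, ?_⟩
  · rw [Matrix.mem_unitaryGroup_iff']
    ext i j
    have := (orthonormal_iff_ite.1 b.orthonormal) i j
    simp only [PiLp.inner_apply, RCLike.inner_apply] at this
    rw [Matrix.mul_apply, Matrix.one_apply, ← this]
    simp [U, mul_comm]
  · have hxx : ‖x‖ ^ 2 = vecNormSq r := by
      rw [EuclideanSpace.norm_sq_eq]; simp [x, vecNormSq]
    rw [hrU, hb0, inner_smul_left, inner_self_eq_norm_sq_to_K, b.norm_eq_one, ← hxx]
    simp
  · intro j
    rw [hrU, hb0, inner_smul_left, (orthonormal_iff_ite.1 b.orthonormal) 0 j.succ,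
      if_neg (Fin.succ_ne_zero j).symm, mul_zero]

theorem stdGaussianMat_map_unitary {n k : ℕ} (U : Matrix (Fin k) (Fin k) ℂ)
    (hU : U ∈ Matrix.unitaryGroup (Fin k) ℂ) :
    (stdGaussianMat n k).map (fun Z i => U *ᵥ Z i) = stdGaussianMat n k := by
  have hm : Measurable fun z : Fin k → ℂ => U *ᵥ z := by
    refine Continuous.measurable ?_
    fun_prop
  have := stdGaussianVec_map_unitary U hU
  have hp : IsProbabilityMeasure ((stdGaussianVec k).map fun z => U *ᵥ z) := by
    rw [this]; infer_instance
  rw [stdGaussianMat, Measure.pi_map_pi (f := fun _ z => U *ᵥ z) fun _ => hm.aemeasurable]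
  simp_rw [this]

theorem stdGaussianVec_map_tail (k : ℕ) :
    (stdGaussianVec (k + 1)).map (fun z j => z (Fin.succ j)) = stdGaussianVec k := by
  have h := (measurePreserving_snd (μ := stdComplexGaussian) (ν := stdGaussianVec k)).comp
    (measurePreserving_piFinSuccAbove (fun _ : Fin (k + 1) => stdComplexGaussian) 0)
  exact h.map_eq

theorem stdGaussianMat_map_tail (n k : ℕ) :
    (stdGaussianMat n (k + 1)).map (fun Z i j => Z i (Fin.succ j)) = stdGaussianMat n k := by
  have hm : Measurable fun (z : Fin (k + 1) → ℂ) (j : Fin k) => z j.succ := by fun_prop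
  have hp : IsProbabilityMeasure ((stdGaussianVec (k + 1)).map fun z j => z (Fin.succ j)) := by
    rw [stdGaussianVec_map_tail]; infer_instance
  have h := Measure.pi_map_pi (μ := fun _ : Fin n => stdGaussianVec (k + 1))
    (f := fun _ (z : Fin (k + 1) → ℂ) (j : Fin k) => z j.succ) fun _ => hm.aemeasurable
  simp_rw [stdGaussianVec_map_tail] at h
  exact h

/-- Conditionally on the first row, a unitary change of coordinates splits off its norm from the
Gram determinant of a Gaussian matrix. -/
theorem stdGaussianMat_map_gramDet (n k : ℕ) :
    (stdGaussianMat (n + 1) (k + 1)).map gramDet =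
      ((stdGaussianVec (k + 1)).prod (stdGaussianMat n k)).map
        fun x => vecNormSq x.1 * gramDet x.2 := by
  have hmp := (measurePreserving_piFinSuccAbove (fun _ : Fin (n + 1) => stdGaussianVec (k + 1)) 0)
  have hm2 : Measurable fun x : (Fin (k + 1) → ℂ) × (Fin n → Fin k → ℂ) =>
      vecNormSq x.1 * gramDet x.2 :=
    (measurable_vecNormSq.comp measurable_fst).mul (measurable_gramDet.comp measurable_snd)
  refine Measure.ext_of_lintegral _ fun h hh => ?_
  rw [lintegral_map hh measurable_gramDet, lintegral_map hh hm2,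
    ← hmp.symm.lintegral_comp (f := fun Z => h (gramDet Z)) (hh.comp measurable_gramDet),
    lintegral_prod _ (by
      exact ((hh.comp measurable_gramDet).comp (MeasurableEquiv.measurable _)).aemeasurable),
    lintegral_prod (fun x => h (vecNormSq x.1 * gramDet x.2)) (hh.comp hm2).aemeasurable]
  -- With the first row r fixed, the rotation U depends on r alone and so preserves the law of the
  -- remaining rows. Right multiplication of rows by U is `Uᵀ *ᵥ`, hence the transposes.
  refine lintegral_congr fun r => ?_
  obtain ⟨U, hU, hU0, hUs⟩ := exists_unitary_vecMul_eq r
  have hUt : Uᵀ ∈ Matrix.unitaryGroup (Fin (k + 1)) ℂ := by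
    rw [Matrix.mem_unitaryGroup_iff, show star Uᵀ = (star U)ᵀ from rfl, ← Matrix.transpose_mul,
      Matrix.mem_unitaryGroup_iff'.1 hU, Matrix.transpose_one]
  have hsplit : ∀ Y : Fin n → Fin (k + 1) → ℂ,
      gramDet ((MeasurableEquiv.piFinSuccAbove (fun _ => Fin (k + 1) → ℂ) 0).symm (r, Y)) =
        vecNormSq r * gramDet fun i j => (Uᵀ *ᵥ Y i) (Fin.succ j) := fun Y => by
    rw [← gramDet_mul_unitary _ U hU, gramDet_eq_of_row_zero, ← hU0]
    · simp [MeasurableEquiv.piFinSuccAbove, Fin.insertNthEquiv, Matrix.mulVec_transpose]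
    · simpa [MeasurableEquiv.piFinSuccAbove, Fin.insertNthEquiv] using hUs
  have hmU : Measurable fun (Z : Fin n → Fin (k + 1) → ℂ) i => Uᵀ *ᵥ Z i := by
    refine Continuous.measurable ?_
    fun_prop
  have hmt : Measurable fun (Z : Fin n → Fin (k + 1) → ℂ) i (j : Fin k) => Z i j.succ := by
    fun_prop
  have hg : Measurable fun Y : Fin n → Fin k → ℂ => h (vecNormSq r * gramDet Y) :=
    hh.comp (measurable_gramDet.const_mul _)
  calc
    _ = ∫⁻ Y, h (vecNormSq r * gramDet fun i j => (Uᵀ *ᵥ Y i) (Fin.succ j))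
          ∂stdGaussianMat n (k + 1) := lintegral_congr fun Y => congrArg h (hsplit Y)
    _ = ∫⁻ Z, h (vecNormSq r * gramDet fun i j => Z i (Fin.succ j))
          ∂(stdGaussianMat n (k + 1)).map fun Z i => Uᵀ *ᵥ Z i :=
        (lintegral_map (hg.comp hmt) hmU).symm
    _ = _ := by
      rw [stdGaussianMat_map_unitary Uᵀ hUt, ← stdGaussianMat_map_tail n k, lintegral_map hg hmt]

/-- Each step removes one row and one column, so the excess d stays fixed; the removed row has n + d
+ 1 coordinates and contributes ψ(n + d + 1). Positivity is carried along because the logarithm of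
the product splits only at nonzero factors. -/
theorem gramDet_stdGaussianMat (d n : ℕ) :
    (∀ᵐ Z ∂stdGaussianMat n (n + d), 0 < gramDet Z) ∧
    Integrable (fun Z => Real.log (gramDet Z)) (stdGaussianMat n (n + d)) ∧
    ∫ Z, Real.log (gramDet Z) ∂stdGaussianMat n (n + d) =
      ∑ j ∈ Finset.range n, (Complex.digamma ((d + j : ℕ) + 1)).re := by
  induction n with
  | zero =>
    have h1 : ∀ Z : Fin 0 → Fin (0 + d) → ℂ, gramDet Z = 1 := fun Z => by simp [gramDet]
    simp [h1]
  | succ n ih =>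
    obtain ⟨hpos, hint, hval⟩ := ih
    rw [show n + 1 + d = (n + d) + 1 by ring]
    have hlaw := stdGaussianMat_map_gramDet n (n + d)
    set P := (stdGaussianVec (n + d + 1)).prod (stdGaussianMat n (n + d)) with hP
    have hm2 : Measurable fun x : (Fin (n + d + 1) → ℂ) × (Fin n → Fin (n + d) → ℂ) =>
        vecNormSq x.1 * gramDet x.2 :=
      (measurable_vecNormSq.comp measurable_fst).mul (measurable_gramDet.comp measurable_snd)
    have hp1 : ∀ᵐ x ∂P, 0 < vecNormSq x.1 :=
      (Measure.quasiMeasurePreserving_fst).ae (ae_vecNormSq_pos (n + d))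
    have hp2 : ∀ᵐ x ∂P, 0 < gramDet x.2 := (Measure.quasiMeasurePreserving_snd).ae hpos
    have hi1 : Integrable (fun x => Real.log (vecNormSq x.1)) P :=
      (integrable_log_vecNormSq (n + d)).comp_fst _
    have hi2 : Integrable (fun x => Real.log (gramDet x.2)) P := hint.comp_snd _
    have hsplit : (fun x => Real.log (vecNormSq x.1) + Real.log (gramDet x.2)) =ᵐ[P]
        fun x => Real.log (vecNormSq x.1 * gramDet x.2) := by
      filter_upwards [hp1, hp2] with x h1 h2 using (Real.log_mul h1.ne' h2.ne').symm
    refine ⟨?_, ?_, ?_⟩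
    · have : ∀ᵐ y ∂P.map (fun x => vecNormSq x.1 * gramDet x.2), 0 < y := by
        rw [ae_map_iff hm2.aemeasurable measurableSet_Ioi]
        filter_upwards [hp1, hp2] with x h1 h2 using mul_pos h1 h2
      rw [← hlaw, ae_map_iff measurable_gramDet.aemeasurable measurableSet_Ioi] at this
      exact this
    · have : Integrable Real.log (P.map fun x => vecNormSq x.1 * gramDet x.2) := by
        rw [integrable_map_measure Real.measurable_log.aestronglyMeasurable hm2.aemeasurable]
        exact (hi1.add hi2).congr hsplit
      rw [← hlaw, integrable_map_measure Real.measurable_log.aestronglyMeasurable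
        measurable_gramDet.aemeasurable] at this
      exact this
    · rw [← integral_map measurable_gramDet.aemeasurable
        Real.measurable_log.aestronglyMeasurable, hlaw, integral_map hm2.aemeasurable
        Real.measurable_log.aestronglyMeasurable, ← integral_congr_ae hsplit,
        integral_add hi1 hi2, Finset.sum_range_succ, ← hval, add_comm]
      congr 1
      · rw [hP, integral_fun_snd fun Y => Real.log (gramDet Y)]; simp
      · rw [hP, integral_fun_fst fun z => Real.log (vecNormSq z), integral_log_vecNormSq,
          add_comm n d]
        simp

end GramDet

/-! ### The matrix logarithm: equivariance, trace, bound, measurability -/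

section MatLog

variable {p : ℕ}

theorem finite_continuousOn_spectrum {A : Matrix (Fin p) (Fin p) ℂ} (f : ℝ → ℝ) :
    ContinuousOn f (spectrum ℝ A) :=
  (Matrix.finite_real_spectrum (A := A)).continuousOn f

/-- Conjugation by U is a continuous star automorphism, and the functional calculus is natural under
these. -/
theorem matLog_conj_unitary {A U : Matrix (Fin p) (Fin p) ℂ} (hA : A.IsHermitian)
    (hU : U ∈ Matrix.unitaryGroup (Fin p) ℂ) :
    matLog (U * A * Uᴴ) = U * matLog A * Uᴴ := by
  have hs : IsSelfAdjoint (U * A * Uᴴ) :=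
    Matrix.isHermitian_mul_mul_conjTranspose U hA
  have h := StarAlgHomClass.map_cfc (S := ℂ) (R := ℝ)
    (Unitary.conjStarAlgAut ℂ (Matrix (Fin p) (Fin p) ℂ) ⟨U, hU⟩) Real.log A
    (finite_continuousOn_spectrum _)
    (by
      change Continuous fun x : Matrix (Fin p) (Fin p) ℂ => U * x * star U
      fun_prop) hA hs
  exact h.symm

theorem matLog_apply {A : Matrix (Fin p) (Fin p) ℂ} (hA : A.IsHermitian) (i j : Fin p) :
    matLog A i j = ∑ k, (hA.eigenvectorUnitary : Matrix (Fin p) (Fin p) ℂ) i k *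
      (Real.log (hA.eigenvalues k) : ℂ) *
        star ((hA.eigenvectorUnitary : Matrix (Fin p) (Fin p) ℂ) j k) := by
  rw [matLog, hA.cfc_eq, Matrix.IsHermitian.cfc, Unitary.conjStarAlgAut_apply,
    Matrix.mul_apply]
  simp [Matrix.mul_diagonal]

theorem trace_matLog {A : Matrix (Fin p) (Fin p) ℂ} (hA : A.PosDef) :
    (matLog A).trace = (Real.log (A.det).re : ℂ) := by
  have h1 : (matLog A).trace = ∑ k, (Real.log (hA.1.eigenvalues k) : ℂ) := by
    rw [matLog, hA.1.cfc_eq, Matrix.IsHermitian.cfc, Unitary.conjStarAlgAut_apply,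
      Matrix.trace_mul_cycle, Unitary.coe_star_mul_self, Matrix.one_mul, Matrix.trace_diagonal]
    simp
  have h2 : A.det = ((∏ k, hA.1.eigenvalues k : ℝ) : ℂ) := by
    rw [hA.1.det_eq_prod_eigenvalues]; simp
  rw [h1, h2, Complex.ofReal_re, Real.log_prod fun k _ => (hA.eigenvalues_pos k).ne']
  simp

/-- Entries of the eigenvector unitary have modulus at most 1, and |log t| ≤ 2t - log t because log
t ≤ t - 1. Summing over eigenvalues leaves only the trace and log det, both integrable under the
Wishart law. -/
theorem norm_matLog_apply_le {A : Matrix (Fin p) (Fin p) ℂ} (hA : A.PosDef) (i j : Fin p) :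
    ‖matLog A i j‖ ≤ 2 * A.trace.re - Real.log A.det.re := by
  have hunit : ∀ i k, ‖(hA.1.eigenvectorUnitary : Matrix (Fin p) (Fin p) ℂ) i k‖ ≤ 1 := fun i k =>
    entry_norm_bound_of_unitary hA.1.eigenvectorUnitary.2 i k
  have hlog : Real.log A.det.re = ∑ k, Real.log (hA.1.eigenvalues k) := by
    rw [← Real.log_prod fun k _ => (hA.eigenvalues_pos k).ne', hA.1.det_eq_prod_eigenvalues,
      ← Complex.ofReal_re (∏ k, hA.1.eigenvalues k)]
    simp
  have htr : A.trace.re = ∑ k, hA.1.eigenvalues k := by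
    rw [hA.1.trace_eq_sum_eigenvalues]; simp
  rw [matLog_apply hA.1, hlog, htr, Finset.mul_sum, ← Finset.sum_sub_distrib]
  refine (norm_sum_le _ _).trans (Finset.sum_le_sum fun k _ => ?_)
  have hpos := hA.eigenvalues_pos k
  set t := hA.1.eigenvalues k
  have habs : |Real.log t| ≤ 2 * t - Real.log t := by
    rw [abs_le]
    constructor <;> linarith [Real.log_le_sub_one_of_pos hpos]
  rw [norm_mul, norm_mul, norm_star, Complex.norm_real, Real.norm_eq_abs]
  calc _ ≤ 1 * |Real.log t| * 1 := by
        gcongr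
        · exact hunit i k
        · exact hunit j k
    _ ≤ _ := by simpa using habs

instance matrixBorelSpace {m n : Type*} [Countable m] [Countable n] :
    BorelSpace (Matrix m n ℂ) :=
  inferInstanceAs (BorelSpace (m → n → ℂ))

theorem measurableSet_posDef : MeasurableSet {A : Matrix (Fin p) (Fin p) ℂ | A.PosDef} := by
  have h : {A : Matrix (Fin p) (Fin p) ℂ | A.PosDef} =
      ({A | Aᴴ = A} ∩ ⋂ x : Fin p → ℂ, {A | 0 ≤ star x ⬝ᵥ (A *ᵥ x)}) ∩ {A | A.det = 0}ᶜ := by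
    ext A
    constructor
    · intro hA
      exact ⟨⟨hA.1, Set.mem_iInter.2 fun x => hA.posSemidef.dotProduct_mulVec_nonneg x⟩,
        hA.det_pos.ne'⟩
    · rintro ⟨⟨h1, h2⟩, h3⟩
      exact ((Matrix.PosSemidef.of_dotProduct_mulVec_nonneg h1
        (Set.mem_iInter.1 h2)).posDef_iff_det_ne_zero).2 h3
  rw [h]
  refine MeasurableSet.inter (IsClosed.measurableSet (IsClosed.inter ?_ (isClosed_iInter fun x => ?_)))
    (IsClosed.measurableSet ?_).compl
  · exact isClosed_eq (by fun_prop) continuous_id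
  · exact isClosed_le continuous_const (by fun_prop)
  · exact isClosed_eq (by fun_prop) continuous_const

open scoped Matrix.Norms.L2Operator in
-- Spectra of positive definite matrices avoid 0, the only discontinuity of `Real.log`. This yields
-- the almost everywhere measurability of `matLog`.
theorem continuousOn_matLog : ContinuousOn (matLog (p := p)) {A | A.PosDef} := by
  refine ContinuousOn.cfc_of_mem_nhdsSet (s := {0}ᶜ) Real.log ?_ continuousOn_id
    (fun A hA => hA.1) Real.continuousOn_log
  refine isOpen_compl_singleton.mem_nhdsSet.2 (Set.iUnion₂_subset fun A hA x hx => ?_)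
  change x ∈ spectrum ℝ A at hx
  rw [hA.1.spectrum_real_eq_range_eigenvalues] at hx
  obtain ⟨i, rfl⟩ := hx
  exact (hA.eigenvalues_pos i).ne'

theorem aemeasurable_matLog {ν : Measure (Matrix (Fin p) (Fin p) ℂ)} (h : ∀ᵐ A ∂ν, A.PosDef) :
    AEMeasurable matLog ν := by
  rw [← Measure.restrict_eq_self_of_ae_mem h]
  exact continuousOn_matLog.aemeasurable measurableSet_posDef

end MatLog

/-! ### Reindexing product measures -/

section Curry

variable {ι κ α : Type*} [Fintype ι] [Fintype κ] [MeasurableSpace α]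

theorem pi_map_curry (ν : Measure α) [IsProbabilityMeasure ν] :
    (Measure.pi fun _ : ι × κ => ν).map (fun z i j => z (i, j)) =
      Measure.pi fun _ : ι => Measure.pi fun _ : κ => ν := by
  have h := Measure.infinitePi_map_curry fun (_ : ι) (_ : κ) => ν
  simp only [Measure.infinitePi_eq_pi] at h
  exact h

theorem pi_map_reindex {κ' : Type*} [Fintype κ'] (e : κ ≃ κ') (ν : Measure α)
    [SigmaFinite ν] :
    (Measure.pi fun _ : κ' => ν).map (fun z i => z (e i)) = Measure.pi fun _ : κ => ν := by
  have h := (measurePreserving_piCongrLeft (fun _ : κ => ν) e.symm).map_eq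
  have h2 : ⇑(MeasurableEquiv.piCongrLeft (fun _ : κ => α) e.symm) = fun z i => z (e i) := by
    ext z i
    have := MeasurableEquiv.piCongrLeft_apply_apply (β := fun _ : κ => α) e.symm z (e i)
    simpa using this
  rw [h2] at h
  exact h

/-- A Wishart sum is indexed by its m vectors in ℂᵖ, whereas the Gram recursion peels off the p rows
of length m; this transposition connects the two. -/
theorem pi_map_swap (ν : Measure α) [IsProbabilityMeasure ν] :
    (Measure.pi fun _ : ι => Measure.pi fun _ : κ => ν).map (fun z j i => z i j) =
      Measure.pi fun _ : κ => Measure.pi fun _ : ι => ν := by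
  rw [← pi_map_curry, ← pi_map_curry, ← pi_map_reindex (Equiv.prodComm κ ι),
    Measure.map_map (by fun_prop) (by fun_prop), Measure.map_map (by fun_prop) (by fun_prop)]
  rfl

end Curry

/-! ### Sums of outer products -/

section OuterSum

variable {p m : ℕ}

/-- The matrix `∑ₖ Xₖ Xₖᴴ`. -/
noncomputable def outerSum {κ : Type*} [Fintype κ] (X : κ → Fin p → ℂ) :
    Matrix (Fin p) (Fin p) ℂ :=
  ∑ k, Matrix.vecMulVec (X k) (star (X k))

theorem continuous_outerSum {κ : Type*} [Fintype κ] :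
    Continuous (outerSum (p := p) (κ := κ)) := by
  unfold outerSum
  fun_prop

theorem measurable_outerSum {κ : Type*} [Fintype κ] : Measurable (outerSum (p := p) (κ := κ)) :=
  continuous_outerSum.measurable

theorem outerSum_eq_mul_conjTranspose (X : Fin m → Fin p → ℂ) :
    outerSum X = Matrix.of (fun i k => X k i) * (Matrix.of fun i k => X k i)ᴴ := by
  ext i j
  simp [outerSum, Matrix.sum_apply, Matrix.mul_apply, Matrix.vecMulVec_apply]

theorem outerSum_mulVec {κ : Type*} [Fintype κ] (B : Matrix (Fin p) (Fin p) ℂ)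
    (X : κ → Fin p → ℂ) : outerSum (fun k => B *ᵥ X k) = B * outerSum X * Bᴴ := by
  simp only [outerSum, Finset.mul_sum, Finset.sum_mul, Matrix.star_mulVec,
    Matrix.mul_vecMulVec, Matrix.vecMulVec_mul]

theorem det_outerSum (X : Fin m → Fin p → ℂ) :
    (outerSum X).det = (gramDet fun i k => X k i : ℝ) := by
  rw [outerSum_eq_mul_conjTranspose, ofReal_gramDet]

theorem posSemidef_outerSum (X : Fin m → Fin p → ℂ) : (outerSum X).PosSemidef := by
  rw [outerSum_eq_mul_conjTranspose]
  exact Matrix.posSemidef_self_mul_conjTranspose _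

theorem trace_outerSum (X : Fin m → Fin p → ℂ) :
    (outerSum X).trace = (∑ k, vecNormSq (X k) : ℝ) := by
  simp only [outerSum, Matrix.trace_sum, Matrix.trace_vecMulVec]
  push_cast
  simp only [ofReal_vecNormSq]

end OuterSum

/-! ### The matrix square root -/

section MatSqrt

variable {p : ℕ}

theorem isHermitian_matSqrt (A : Matrix (Fin p) (Fin p) ℂ) : (matSqrt A).IsHermitian :=
  cfc_predicate Real.sqrt A

theorem matSqrt_mul_self {A : Matrix (Fin p) (Fin p) ℂ} (hA : A.PosDef) :
    matSqrt A * matSqrt A = A := by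
  have hs : IsSelfAdjoint A := hA.1
  rw [matSqrt, ← cfc_mul Real.sqrt Real.sqrt A (finite_continuousOn_spectrum _)
    (finite_continuousOn_spectrum _)]
  conv_rhs => rw [← cfc_id ℝ A hs]
  refine cfc_congr fun x hx => ?_
  rw [hA.1.spectrum_real_eq_range_eigenvalues] at hx
  obtain ⟨i, rfl⟩ := hx
  exact Real.mul_self_sqrt (hA.eigenvalues_pos i).le

theorem isUnit_det_matSqrt {A : Matrix (Fin p) (Fin p) ℂ} (hA : A.PosDef) :
    IsUnit (matSqrt A).det := by
  refine isUnit_iff_ne_zero.2 fun h => hA.det_pos.ne' ?_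
  rw [← matSqrt_mul_self hA, Matrix.det_mul, h, zero_mul]

end MatSqrt

/-! ### The normalised Wishart law and its mean logarithm -/

section Wishart

variable {p : ℕ}

theorem measurable_mulVec_const {m n : ℕ} (B : Matrix (Fin m) (Fin n) ℂ) :
    Measurable fun z : Fin n → ℂ => B *ᵥ z := by
  refine Continuous.measurable ?_
  fun_prop

theorem complexWishart_eq_map (m : ℕ) (Sig : Matrix (Fin p) (Fin p) ℂ) :
    complexWishart m Sig = (stdGaussianMat m p).map
      fun Z => matSqrt Sig * outerSum Z * matSqrt Sig := by
  have hm := measurable_mulVec_const (matSqrt Sig)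
  have hp : IsProbabilityMeasure ((stdGaussianVec p).map fun z => matSqrt Sig *ᵥ z) :=
    Measure.isProbabilityMeasure_map hm.aemeasurable
  have h := Measure.pi_map_pi (μ := fun _ : Fin m => stdGaussianVec p)
    (f := fun _ z => matSqrt Sig *ᵥ z) fun _ => hm.aemeasurable
  have h2 : (fun X : Fin m → Fin p → ℂ => ∑ k, Matrix.vecMulVec (X k) (star (X k))) = outerSum :=
    rfl
  rw [complexWishart, h2]
  simp only [complexGaussian]
  have hmZ : Measurable fun (Z : Fin m → Fin p → ℂ) i => matSqrt Sig *ᵥ Z i :=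
    measurable_pi_lambda _ fun i => hm.comp (measurable_pi_apply i)
  rw [← h, Measure.map_map measurable_outerSum hmZ]
  congr 1
  ext Z : 1
  simp only [Function.comp_apply, outerSum_mulVec]
  rw [(isHermitian_matSqrt Sig).eq]

/-- The law of `m⁻¹ W`, where `W` has the complex Wishart law with `m` degrees of freedom and
identity scale matrix. -/
noncomputable def normWishart (p m : ℕ) : Measure (Matrix (Fin p) (Fin p) ℂ) :=
  (stdGaussianMat m p).map fun Z => (1 / (m : ℝ)) • outerSum Z

theorem measurable_smul_outerSum (m : ℕ) :
    Measurable fun Z : Fin m → Fin p → ℂ => (1 / (m : ℝ)) • outerSum Z :=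
  (continuous_outerSum.const_smul (1 / (m : ℝ))).measurable

theorem gramDet_swap_stdGaussianMat (d p : ℕ) :
    (∀ᵐ Z ∂stdGaussianMat (p + d) p, 0 < gramDet fun i k => Z k i) ∧
    Integrable (fun Z => Real.log (gramDet fun i k => Z k i)) (stdGaussianMat (p + d) p) ∧
    ∫ Z, Real.log (gramDet fun i k => Z k i) ∂stdGaussianMat (p + d) p =
      ∑ j ∈ Finset.range p, (Complex.digamma ((d + j : ℕ) + 1)).re := by
  have hmp : MeasurePreserving (fun (Z : Fin (p + d) → Fin p → ℂ) i k => Z k i)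
      (stdGaussianMat (p + d) p) (stdGaussianMat p (p + d)) :=
    ⟨by fun_prop, pi_map_swap _⟩
  obtain ⟨h1, h2, h3⟩ := gramDet_stdGaussianMat d p
  refine ⟨hmp.quasiMeasurePreserving.ae h1, hmp.integrable_comp_of_integrable h2, ?_⟩
  have hlog : Measurable fun Z : Fin p → Fin (p + d) → ℂ => Real.log (gramDet Z) :=
    Real.measurable_log.comp measurable_gramDet
  rw [← h3, ← hmp.map_eq, integral_map hmp.measurable.aemeasurable hlog.aestronglyMeasurable]

theorem ae_posDef_smul_outerSum {m : ℕ} (hp : 1 ≤ p) (hm : p ≤ m) :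
    ∀ᵐ Z ∂stdGaussianMat m p, ((1 / (m : ℝ)) • outerSum Z).PosDef := by
  obtain ⟨d, rfl⟩ := Nat.exists_eq_add_of_le hm
  filter_upwards [(gramDet_swap_stdGaussianMat d p).1] with Z hZ
  have hpos : 0 < 1 / ((p + d : ℕ) : ℝ) := by
    have : 0 < p + d := by omega
    positivity
  refine Matrix.PosDef.smul ((posSemidef_outerSum Z).posDef_iff_det_ne_zero.2 ?_) hpos
  rw [det_outerSum]
  exact_mod_cast hZ.ne'

theorem ae_posDef_normWishart {m : ℕ} (hp : 1 ≤ p) (hm : p ≤ m) :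
    ∀ᵐ A ∂normWishart p m, A.PosDef := by
  rw [normWishart, ae_map_iff (measurable_smul_outerSum m).aemeasurable measurableSet_posDef]
  exact ae_posDef_smul_outerSum hp hm

theorem normWishart_map_unitary (m : ℕ) {U : Matrix (Fin p) (Fin p) ℂ}
    (hU : U ∈ Matrix.unitaryGroup (Fin p) ℂ) :
    (normWishart p m).map (fun A => U * A * Uᴴ) = normWishart p m := by
  have hc : Measurable fun A : Matrix (Fin p) (Fin p) ℂ => U * A * Uᴴ :=
    Continuous.measurable (by fun_prop)
  have hm : Measurable fun (Z : Fin m → Fin p → ℂ) k => U *ᵥ Z k :=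
    measurable_pi_lambda _ fun i => (measurable_mulVec_const U).comp (measurable_pi_apply i)
  conv_rhs => rw [normWishart, ← stdGaussianMat_map_unitary U hU]
  rw [normWishart, Measure.map_map hc (measurable_smul_outerSum m),
    Measure.map_map (measurable_smul_outerSum m) hm]
  congr 1
  ext Z : 1
  simp [outerSum_mulVec]

theorem log_det_smul_outerSum {m : ℕ} (hm : 1 ≤ m) {Z : Fin m → Fin p → ℂ}
    (hZ : 0 < gramDet fun i k => Z k i) :
    Real.log (((1 / (m : ℝ)) • outerSum Z).det).re =
      Real.log (gramDet fun i k => Z k i) - p * Real.log m := by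
  have hm0 : (0 : ℝ) < m := by exact_mod_cast hm
  have : ((1 / (m : ℝ)) • outerSum Z).det =
      (((1 / (m : ℝ)) ^ p * gramDet fun i k => Z k i : ℝ) : ℂ) := by
    rw [← Complex.coe_smul (1 / (m : ℝ)) (outerSum Z), Matrix.det_smul, det_outerSum]
    simp
  rw [this, Complex.ofReal_re, Real.log_mul (by positivity) hZ.ne', Real.log_pow, one_div,
    Real.log_inv]
  ring

theorem integrable_matLog_normWishart {m : ℕ} (hp : 1 ≤ p) (hm : p ≤ m) (i j : Fin p) :
    Integrable (fun A => matLog A i j) (normWishart p m) := by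
  have hae := ae_posDef_normWishart hp hm
  have hmeas : AEMeasurable (fun A : Matrix (Fin p) (Fin p) ℂ => matLog A i j) (normWishart p m) :=
    (Continuous.matrix_elem continuous_id i j).measurable.comp_aemeasurable
      (aemeasurable_matLog hae)
  rw [normWishart] at hmeas ⊢
  rw [integrable_map_measure hmeas.aestronglyMeasurable (measurable_smul_outerSum m).aemeasurable]
  obtain ⟨d, rfl⟩ := Nat.exists_eq_add_of_le hm
  obtain ⟨h1, h2, -⟩ := gramDet_swap_stdGaussianMat d p
  have htr : Integrable (fun Z : Fin (p + d) → Fin p → ℂ => ∑ k, vecNormSq (Z k))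
      (stdGaussianMat (p + d) p) :=
    integrable_finsetSum _ fun k _ =>
      (measurePreserving_eval (fun _ : Fin (p + d) => stdGaussianVec p) k).integrable_comp_of_integrable
        (integrable_vecNormSq p)
  refine Integrable.mono' (((htr.const_mul (2 * (1 / ((p + d : ℕ) : ℝ)))).sub
    (h2.sub (integrable_const (p * Real.log (p + d : ℕ))))))
    (hmeas.aestronglyMeasurable.comp_measurable (measurable_smul_outerSum _)) ?_
  filter_upwards [h1, ae_posDef_smul_outerSum hp hm] with Z hZ hpd
  refine (norm_matLog_apply_le hpd i j).trans_eq ?_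
  rw [log_det_smul_outerSum (by omega) hZ, Matrix.trace_smul, trace_outerSum]
  simp only [Complex.smul_re, Complex.ofReal_re, smul_eq_mul, Pi.sub_apply]
  ring

theorem integral_trace_matLog_normWishart {m : ℕ} (hp : 1 ≤ p) (hm : p ≤ m) :
    ∫ A, (matLog A).trace ∂normWishart p m =
      ((∑ j ∈ Finset.range p, (Complex.digamma ((m - p + j : ℕ) + 1)).re -
        p * Real.log m : ℝ) : ℂ) := by
  have hae := ae_posDef_normWishart hp hm
  have h1 : ∫ A, (matLog A).trace ∂normWishart p m =
      ∫ A, ((Real.log (A.det).re : ℝ) : ℂ) ∂normWishart p m :=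
    integral_congr_ae (by filter_upwards [hae] with A hA using trace_matLog hA)
  have hdet : Measurable fun A : Matrix (Fin p) (Fin p) ℂ => Real.log (A.det).re :=
    Real.measurable_log.comp (Continuous.measurable (by fun_prop))
  rw [h1, integral_complex_ofReal, normWishart,
    integral_map (measurable_smul_outerSum m).aemeasurable hdet.aestronglyMeasurable]
  obtain ⟨d, rfl⟩ := Nat.exists_eq_add_of_le hm
  obtain ⟨g1, g2, g3⟩ := gramDet_swap_stdGaussianMat d p
  congr 1
  rw [Nat.add_sub_cancel_left, ← g3, integral_congr_ae (g := fun Z =>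
    Real.log (gramDet fun i k => Z k i) - p * Real.log (p + d : ℕ)) (by
      filter_upwards [g1] with Z hZ using log_det_smul_outerSum (by omega) hZ),
    integral_sub g2 (integrable_const _)]
  simp

/-- Two kinds of unitaries suffice: flipping the sign of one coordinate kills the off-diagonal
entries, and swapping two coordinates equates the diagonal ones. -/
theorem eq_smul_one_of_unitary_conj (M : Matrix (Fin p) (Fin p) ℂ)
    (h : ∀ U ∈ Matrix.unitaryGroup (Fin p) ℂ, U * M * Uᴴ = M) :
    ∃ c : ℂ, M = c • (1 : Matrix (Fin p) (Fin p) ℂ) := by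
  have hoff : ∀ i j, i ≠ j → M i j = 0 := fun i j hij => by
    let D : Matrix (Fin p) (Fin p) ℂ := Matrix.diagonal fun k => if k = i then -1 else 1
    have hD : Dᴴ = D := by
      simp only [D, Matrix.diagonal_conjTranspose]
      congr 1
      ext k
      by_cases hk : k = i <;> simp [hk]
    have hDD : D * D = 1 := by
      rw [Matrix.diagonal_mul_diagonal, ← Matrix.diagonal_one]
      congr 1
      ext k
      by_cases hk : k = i <;> simp [hk]
    have hDU : D ∈ Matrix.unitaryGroup (Fin p) ℂ := by
      rw [Matrix.mem_unitaryGroup_iff, Matrix.star_eq_conjTranspose, hD, hDD]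
    have := congrFun (congrFun (h D hDU) i) j
    rw [hD] at this
    simp only [D, Matrix.mul_diagonal, Matrix.diagonal_mul, if_true, if_neg hij.symm] at this
    have h2 : M i j + M i j = 0 := by linear_combination -this
    simpa using h2
  have hdiag : ∀ i j, M i i = M j j := fun i j => by
    let V : Matrix (Fin p) (Fin p) ℂ := (1 : Matrix (Fin p) (Fin p) ℂ).submatrix (Equiv.swap i j) id
    have hVX : ∀ X : Matrix (Fin p) (Fin p) ℂ, V * X = X.submatrix (Equiv.swap i j) id := fun X => by
      ext a b
      simp [V, Matrix.mul_apply, Matrix.one_apply]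
    have hXV : ∀ X : Matrix (Fin p) (Fin p) ℂ, X * Vᴴ = X.submatrix id (Equiv.swap i j) := fun X => by
      rw [← Matrix.conjTranspose_conjTranspose X, ← Matrix.conjTranspose_mul, hVX]
      rfl
    have hVU : V ∈ Matrix.unitaryGroup (Fin p) ℂ := by
      rw [Matrix.mem_unitaryGroup_iff, Matrix.star_eq_conjTranspose, hXV]
      ext a b
      simp [V, Matrix.one_apply]
    have := congrFun (congrFun (h V hVU) j) j
    rw [hVX, hXV] at this
    simpa using this
  rcases isEmpty_or_nonempty (Fin p) with he | ⟨⟨i⟩⟩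
  · exact ⟨0, Subsingleton.elim _ _⟩
  · refine ⟨M i i, ?_⟩
    ext a b
    by_cases hab : a = b
    · subst hab; simp [hdiag a i]
    · simp [hab, hoff a b hab]

theorem integral_mul_mul_apply {Ω : Type*} [MeasurableSpace Ω] {μ : Measure Ω}
    {F : Ω → Matrix (Fin p) (Fin p) ℂ} (hF : ∀ i j, Integrable (fun ω => F ω i j) μ)
    (B C : Matrix (Fin p) (Fin p) ℂ) (i j : Fin p) :
    Integrable (fun ω => (B * F ω * C) i j) μ ∧
      ∫ ω, (B * F ω * C) i j ∂μ = (B * matExpect μ F * C) i j := by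
  have hexp : ∀ X : Matrix (Fin p) (Fin p) ℂ,
      (B * X * C) i j = ∑ b, ∑ a, B i a * X a b * C b j := fun X => by
    simp only [Matrix.mul_apply, Finset.sum_mul]
  have hint : ∀ a b, Integrable (fun ω => B i a * F ω a b * C b j) μ := fun a b =>
    ((hF a b).const_mul _).mul_const _
  simp only [hexp]
  refine ⟨integrable_finsetSum _ fun b _ => integrable_finsetSum _ fun a _ => hint a b, ?_⟩
  rw [integral_finsetSum _ fun b _ => integrable_finsetSum _ fun a _ => hint a b]
  refine Finset.sum_congr rfl fun b _ => ?_
  rw [integral_finsetSum _ fun a _ => hint a b]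
  refine Finset.sum_congr rfl fun a _ => ?_
  rw [integral_mul_const, integral_const_mul]
  rfl

theorem aZero_eq {m : ℕ} (hp : 1 ≤ p) (hm : p ≤ m) :
    (p : ℝ) * aZero p m =
      ∑ j ∈ Finset.range p, (Complex.digamma ((m - p + j : ℕ) + 1)).re - p * Real.log m := by
  have hm0 : (0 : ℝ) < m := by exact_mod_cast (hp.trans hm)
  have hp0 : (p : ℝ) ≠ 0 := by positivity
  -- The shift from 1, ..., p to 0, ..., p-1 is absorbed by the + 1 in the digamma argument.
  have hsum : ∑ j ∈ Finset.Icc 1 p, (Complex.digamma ((m : ℂ) - p + j)).re =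
      ∑ j ∈ Finset.range p, (Complex.digamma ((m - p + j : ℕ) + 1)).re := by
    rw [← Finset.Ico_add_one_right_eq_Icc, Finset.sum_Ico_eq_sum_range]
    refine Finset.sum_congr (by simp) fun j _ => ?_
    congr 2
    push_cast [Nat.cast_sub hm]
    ring
  rw [aZero, aConst, hsum, Real.log_mul (by positivity) (by positivity),
    Real.log_rpow (Real.exp_pos _), Real.log_exp, one_div, Real.log_inv]
  field_simp
  ring

theorem matExpect_matLog_normWishart {m : ℕ} (hp : 1 ≤ p) (hm : p ≤ m) :
    matExpect (normWishart p m) matLog =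
      (aZero p m : ℂ) • (1 : Matrix (Fin p) (Fin p) ℂ) := by
  have hint := integrable_matLog_normWishart hp hm
  have hae := ae_posDef_normWishart hp hm
  obtain ⟨c, hc⟩ := eq_smul_one_of_unitary_conj (matExpect (normWishart p m) matLog) fun U hU => by
    ext i j
    have hcm : Measurable fun A : Matrix (Fin p) (Fin p) ℂ => U * A * Uᴴ :=
      Continuous.measurable (by fun_prop)
    have hmeas : AEStronglyMeasurable (fun A : Matrix (Fin p) (Fin p) ℂ => matLog A i j)
        ((normWishart p m).map fun A => U * A * Uᴴ) := by
      rw [normWishart_map_unitary m hU]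
      exact (hint i j).aestronglyMeasurable
    rw [← (integral_mul_mul_apply hint U Uᴴ i j).2]
    calc _ = ∫ A, matLog (U * A * Uᴴ) i j ∂normWishart p m := integral_congr_ae (by
          filter_upwards [hae] with A hA
          rw [matLog_conj_unitary hA.1 hU])
      _ = _ := by
          rw [← integral_map hcm.aemeasurable hmeas, normWishart_map_unitary m hU]
          rfl
  have htr : (matExpect (normWishart p m) matLog).trace = (p * aZero p m : ℝ) := by
    rw [aZero_eq hp hm, ← integral_trace_matLog_normWishart hp hm]
    simp only [Matrix.trace, Matrix.diag_apply]
    rw [integral_finsetSum _ fun i _ => hint i i]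
    rfl
  rw [hc, Matrix.trace_smul, Matrix.trace_one, Fintype.card_fin, smul_eq_mul] at htr
  have hp0 : (p : ℂ) ≠ 0 := by exact_mod_cast (by omega : p ≠ 0)
  rw [hc, show c = aZero p m from mul_right_cancel₀ hp0 (by rw [htr]; push_cast; ring)]

end Wishart

/-! ### Law of the sample mean and whitening -/

section SampleMean

variable {p : ℕ}

instance {m n : Type*} : MeasurableAdd₂ (Matrix m n ℂ) :=
  inferInstanceAs (MeasurableAdd₂ (m → n → ℂ))

instance (Sig : Matrix (Fin p) (Fin p) ℂ) : IsProbabilityMeasure (complexGaussian Sig) :=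
  Measure.isProbabilityMeasure_map (measurable_mulVec_const _).aemeasurable

theorem pi_complexWishart_map_sum (K N : ℕ) (Sig : Matrix (Fin p) (Fin p) ℂ) :
    (Measure.pi fun _ : Fin N => complexWishart K Sig).map (fun A => ∑ n, A n) =
      complexWishart (K * N) Sig := by
  have hO := measurable_outerSum (p := p) (κ := Fin K)
  have hp : IsProbabilityMeasure ((Measure.pi fun _ : Fin K => complexGaussian Sig).map outerSum) :=
    Measure.isProbabilityMeasure_map hO.aemeasurable
  have h := Measure.pi_map_pi (μ := fun _ : Fin N => Measure.pi fun _ : Fin K => complexGaussian Sig)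
    (f := fun _ => outerSum) fun _ => hO.aemeasurable
  have hO' : Measurable fun (X : Fin N → Fin K → Fin p → ℂ) n => outerSum (X n) :=
    measurable_pi_lambda _ fun n => hO.comp (measurable_pi_apply n)
  have hsum : Measurable fun A : Fin N → Matrix (Fin p) (Fin p) ℂ => ∑ n, A n :=
    Finset.measurable_sum _ fun n _ => measurable_pi_apply n
  -- The factors are exchanged first because `finProdFinEquiv` would otherwise land in `Fin (N *
  -- K)`.
  let e : Fin N × Fin K ≃ Fin (K * N) := (Equiv.prodComm _ _).trans finProdFinEquiv
  have hW : ∀ m, complexWishart m Sig =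
    (Measure.pi fun _ : Fin m => complexGaussian Sig).map outerSum := fun m => rfl
  simp only [hW]
  rw [← h, Measure.map_map hsum hO', ← pi_map_curry, ← pi_map_reindex e,
    Measure.map_map (hsum.comp hO') (by fun_prop),
    Measure.map_map ((hsum.comp hO').comp (by fun_prop)) (by fun_prop)]
  congr 1
  ext X : 1
  simp only [Function.comp_apply, outerSum]
  rw [← Fintype.sum_prod_type' fun n k =>
    Matrix.vecMulVec (X (e (n, k))) (star (X (e (n, k))))]
  exact Equiv.sum_comp e fun k => Matrix.vecMulVec (X k) (star (X k))

variable {Ω : Type*} [MeasurableSpace Ω] {μ : Measure Ω} {K N : ℕ}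
  {Sig : Matrix (Fin p) (Fin p) ℂ} {S : Fin N → Ω → Matrix (Fin p) (Fin p) ℂ}

theorem hasLaw_smul_sampleMean (hN : 1 ≤ N) (hindep : iIndepFun S μ)
    (hlaw : ∀ n, HasLaw (fun ω => (K : ℝ) • S n ω) (complexWishart K Sig) μ) :
    HasLaw (fun ω => ((K * N : ℕ) : ℝ) • sampleMean S ω) (complexWishart (K * N) Sig) μ := by
  have hsmul : Measurable fun A : Matrix (Fin p) (Fin p) ℂ => (K : ℝ) • A :=
    (continuous_const_smul (K : ℝ)).measurable
  have hpi := iIndepFun.hasLaw_pi hlaw (hindep.comp (fun _ A => (K : ℝ) • A) fun _ => hsmul)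
  have hsum : Measurable fun A : Fin N → Matrix (Fin p) (Fin p) ℂ => ∑ n, A n :=
    Finset.measurable_sum _ fun n _ => measurable_pi_apply n
  have hmp : MeasurePreserving (fun A : Fin N → Matrix (Fin p) (Fin p) ℂ => ∑ n, A n)
      (Measure.pi fun _ : Fin N => complexWishart K Sig) (complexWishart (K * N) Sig) :=
    ⟨hsum, pi_complexWishart_map_sum K N Sig⟩
  have key := hmp.fun_comp_hasLaw hpi
  have hN0 : (N : ℝ) ≠ 0 := by positivity
  have heq : (fun ω => ((K * N : ℕ) : ℝ) • sampleMean S ω) = fun ω => ∑ n, (K : ℝ) • S n ω := by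
    ext1 ω
    rw [sampleMean, smul_smul, ← Finset.smul_sum]
    congr 1
    push_cast
    field_simp
  rw [heq]
  exact key

theorem hasLaw_whitened {m : ℕ} (hm : 1 ≤ m) (hSig : Sig.PosDef)
    {T : Ω → Matrix (Fin p) (Fin p) ℂ}
    (hT : HasLaw (fun ω => (m : ℝ) • T ω) (complexWishart m Sig) μ) :
    HasLaw (fun ω => (matSqrt Sig)⁻¹ * T ω * (matSqrt Sig)⁻¹) (normWishart p m) μ := by
  have hu := isUnit_det_matSqrt hSig
  set R := matSqrt Sig with hR
  have hm0 : (m : ℝ) ≠ 0 := by positivity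
  have hg : Measurable fun A : Matrix (Fin p) (Fin p) ℂ => (1 / (m : ℝ)) • (R⁻¹ * A * R⁻¹) :=
    Continuous.measurable (by fun_prop)
  have hRO : Measurable fun Z : Fin m → Fin p → ℂ => R * outerSum Z * R :=
    Continuous.measurable ((continuous_const.mul continuous_outerSum).mul continuous_const)
  have hmp : MeasurePreserving (fun A : Matrix (Fin p) (Fin p) ℂ => (1 / (m : ℝ)) • (R⁻¹ * A * R⁻¹))
      (complexWishart m Sig) (normWishart p m) := by
    refine ⟨hg, ?_⟩
    rw [complexWishart_eq_map, ← hR, Measure.map_map hg hRO, normWishart]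
    congr 1
    ext Z : 1
    simp only [Function.comp_apply]
    rw [Matrix.mul_assoc, Matrix.mul_nonsing_inv_cancel_right _ _ hu,
      Matrix.nonsing_inv_mul_cancel_left _ _ hu]
  have key := hmp.fun_comp_hasLaw hT
  have heq : (fun ω => R⁻¹ * T ω * R⁻¹) =
      fun ω => (1 / (m : ℝ)) • (R⁻¹ * ((m : ℝ) • T ω) * R⁻¹) := by
    ext1 ω
    rw [Matrix.mul_smul, Matrix.smul_mul, smul_smul, one_div_mul_cancel hm0, one_smul]
  rw [heq]
  exact key

theorem scaledNorm_smul_self_sq (hSig : Sig.PosDef) (c : ℝ) :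
    scaledNorm Sig ((c : ℂ) • Sig) ^ 2 = p * c ^ 2 := by
  have hu : IsUnit Sig.det := isUnit_iff_ne_zero.2 hSig.det_pos.ne'
  have h : scaledInner Sig ((c : ℂ) • Sig) ((c : ℂ) • Sig) = p * c ^ 2 := by
    have : Sig⁻¹ * ((c : ℂ) • Sig) = (c : ℂ) • (1 : Matrix (Fin p) (Fin p) ℂ) := by
      rw [Matrix.mul_smul, Matrix.nonsing_inv_mul _ hu]
    rw [scaledInner, Matrix.mul_assoc, this, Matrix.smul_mul, Matrix.one_mul, smul_smul,
      Matrix.trace_smul, Matrix.trace_one, Fintype.card_fin, smul_eq_mul]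
    norm_cast
    ring
  rw [scaledNorm, h, Real.sq_sqrt (by positivity)]

end SampleMean

theorem mainTheorem3 {Ω : Type*} [MeasurableSpace Ω] (μ : Measure Ω) [IsProbabilityMeasure μ]
    (p K N : ℕ) (hp : 1 ≤ p) (hK : p ≤ K) (hN : 1 ≤ N)
    (Sig : Matrix (Fin p) (Fin p) ℂ) (hSig : Sig.PosDef)
    (S : Fin N → Ω → Matrix (Fin p) (Fin p) ℂ)
    (hindep : iIndepFun S μ)
    (hlaw : ∀ n, HasLaw (fun ω => (K : ℝ) • S n ω) (complexWishart K Sig) μ) :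
    HasLaw (fun ω => ((K * N : ℕ) : ℝ) • sampleMean S ω) (complexWishart (K * N) Sig) μ ∧
    (∀ᵐ ω ∂μ, (sampleMean S ω).PosDef) ∧
    (∀ i j, Integrable (fun ω => Lmap Sig (sampleMean S ω) i j) μ) ∧
    ibias μ Sig (sampleMean S) = (p : ℝ) * aZero p (K * N) ^ 2 := by
  have hm : p ≤ K * N := hK.trans (Nat.le_mul_of_pos_right K hN)
  have hu := isUnit_det_matSqrt hSig
  have hRR := matSqrt_mul_self hSig
  have hT := hasLaw_smul_sampleMean hN hindep hlaw
  have hB := hasLaw_whitened (hp.trans hm) hSig hT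
  set B := fun ω => (matSqrt Sig)⁻¹ * sampleMean S ω * (matSqrt Sig)⁻¹ with hBdef
  have hBpos : ∀ᵐ ω ∂μ, (B ω).PosDef := by
    have := ae_posDef_normWishart hp hm
    rw [← hB.map_eq, ae_map_iff hB.aemeasurable measurableSet_posDef] at this
    exact this
  have hlog : ∀ i j, Integrable (fun ω => matLog (B ω) i j) μ := fun i j => by
    have := integrable_matLog_normWishart hp hm i j
    rw [← hB.map_eq] at this
    exact this.comp_aemeasurable hB.aemeasurable
  have hexp : matExpect μ (fun ω => matLog (B ω)) =
      (aZero p (K * N) : ℂ) • (1 : Matrix (Fin p) (Fin p) ℂ) := by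
    rw [← matExpect_matLog_normWishart hp hm]
    ext i j
    exact hB.integral_comp (integrable_matLog_normWishart hp hm i j).aestronglyMeasurable
  refine ⟨hT, ?_, fun i j => (integral_mul_mul_apply hlog (matSqrt Sig) (matSqrt Sig) i j).1, ?_⟩
  -- The sample mean is recovered from the whitened matrix by congruence with the invertible square
  -- root, which preserves positive definiteness.
  · filter_upwards [hBpos] with ω hω
    have hinj : Function.Injective (matSqrt Sig).vecMul :=
      Matrix.vecMul_injective_of_isUnit ((Matrix.isUnit_iff_isUnit_det _).2 hu)
    have h := hω.mul_mul_conjTranspose_same hinj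
    rw [(isHermitian_matSqrt Sig).eq] at h
    simp only [B] at h
    rwa [Matrix.mul_assoc ((matSqrt Sig)⁻¹), Matrix.mul_nonsing_inv_cancel_left _ _ hu,
      Matrix.nonsing_inv_mul_cancel_right _ _ hu] at h
  · have hE : matExpect μ (fun ω => Lmap Sig (sampleMean S ω)) =
        (aZero p (K * N) : ℂ) • Sig := by
      ext i j
      refine (integral_mul_mul_apply hlog (matSqrt Sig) (matSqrt Sig) i j).2.trans ?_
      rw [hexp, Matrix.mul_smul, Matrix.mul_one, Matrix.smul_mul, hRR]
    rw [ibias, hE, scaledNorm_smul_self_sq hSig]
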